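/- Call a finite simple graph on $n$ vertices degree 3-critical if it has exactly $2n-2$ edges and no proper induced subgraph of minimum degree at least $3$. There is an absolute constant $C$ such that, for every $n$, every degree 3-critical graph $G$ on $n$ vertices contains cycles of at least $$\frac{\log_2 n}{3+\log_2 3}-C$$ distinct lengths; that is, the set of all lengths of cycles in $G$ has at least this many elements. -/

import Mathlib

namespace SimpleGraph

/-- A finite graph on `n` vertices is degree 3-critical if it has `2n - 2` edges (written without
subtraction) and no proper induced subgraph has minimum degree at least 3. The empty vertex set is
harmless here, since the minimum degree of the graph without vertices is `0` by convention. -/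
def IsDegreeThreeCritical {V : Type*} [Fintype V] (G : SimpleGraph V) : Prop :=
  open Classical in
  G.edgeFinset.card + 2 = 2 * Fintype.card V ∧
    ∀ S : Finset V, S ≠ Finset.univ → ¬ 3 ≤ (G.induce (S : Set V)).minDegree

/-- The set of lengths of cycles in a graph. -/
def cycleLengths {V : Type*} (G : SimpleGraph V) : Set ℕ :=
  {l | ∃ (v : V) (c : G.Walk v v), c.IsCycle ∧ c.length = l}

end SimpleGraph

/-! Let s be the number of cycle lengths. The aim is n ≤ 24^(s+2), which suffices because log₂ 24 =
3 + log₂ 3. Criticality lets the graph be dismantled, from any chosen first vertex, by deleting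
vertices with at most two remaining neighbours, and the count of 2n - 2 edges makes this tight. When
the first vertex u has degree at most 3, every vertex but the last two has two later neighbours and
every vertex but u has an earlier one (`exists_order`). Let the rank of a vertex be the length of a
longest path leaving it along which the order increases.

Rank classes are small. The vertices of rank at least r form a tree of maximum degree at most 3 via
earlier neighbours, those of smaller rank form a tree via later neighbours, and every vertex of rank
r sends an edge across. Any two such edges close a cycle, so `card_le_crossingBound` gives O(3^s)
vertices of each rank.

There are few ranks. In the tree of rank-decreasing edges, a second later neighbour at each vertex
of a root path starts an ear returning to that path. The crossing bound, now with a path as first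
tree, shows that O(2^s) ears pass over any position (`congestion_le`). Hence no ear is long, since
it would span many independent detours (`ear_le_of_congestion_le`), and then the path is short,
since short ears chain into ever longer cycles (`le_mul_of_ear_le`). This gives O(s² 4^s) ranks, and
s² is absorbed by 2^s. -/

namespace SimpleGraph

variable {V : Type*} {G : SimpleGraph V}

/-! ### Paths confined to a vertex set -/

/-- There is a path of length `l` from `a` to `b` in `G` all of whose vertices lie in `X`. -/
def HasPathIn (G : SimpleGraph V) (X : Set V) (a b : V) (l : ℕ) : Prop :=
  ∃ w : G.Walk a b, w.IsPath ∧ w.length = l ∧ ∀ v ∈ w.support, v ∈ X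

namespace HasPathIn

theorem refl {X : Set V} {a : V} (ha : a ∈ X) : G.HasPathIn X a a 0 :=
  ⟨.nil, .nil, rfl, by simpa using ha⟩

theorem mono {X Y : Set V} {a b : V} {l : ℕ} (h : G.HasPathIn X a b l) (hXY : X ⊆ Y) :
    G.HasPathIn Y a b l := by
  obtain ⟨w, hw, hl, hs⟩ := h
  exact ⟨w, hw, hl, fun v hv => hXY (hs v hv)⟩

theorem symm {X : Set V} {a b : V} {l : ℕ} (h : G.HasPathIn X a b l) :
    G.HasPathIn X b a l := by
  obtain ⟨w, hw, hl, hs⟩ := h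
  exact ⟨w.reverse, hw.reverse, by simpa using hl, by simpa using hs⟩

theorem cons {X : Set V} {a b c : V} {l : ℕ} (hab : G.Adj a b) (h : G.HasPathIn X b c l)
    (ha : a ∉ X) : G.HasPathIn (insert a X) a c (l + 1) := by
  obtain ⟨w, hw, hl, hs⟩ := h
  refine ⟨.cons hab w, hw.cons fun h' => ha (hs _ h'), by simp [hl], ?_⟩
  intro v hv
  rw [Walk.support_cons, List.mem_cons] at hv
  exact hv.imp id (hs v)

theorem append {X Y : Set V} {a b c : V} {l l' : ℕ} (h : G.HasPathIn X a b l)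
    (h' : G.HasPathIn Y b c l') (hXY : ∀ v ∈ X, v ∈ Y → v = b) :
    G.HasPathIn (X ∪ Y) a c (l + l') := by
  obtain ⟨w, hw, hl, hs⟩ := h
  obtain ⟨w', hw', hl', hs'⟩ := h'
  refine ⟨w.append w', ?_, by simp [hl, hl'], ?_⟩
  · rw [Walk.isPath_def, Walk.support_append, List.nodup_append]
    refine ⟨hw.support_nodup, hw'.support_nodup.tail, ?_⟩
    rintro x hx _ hy rfl
    have hxb := hXY x (hs x hx) (hs' x (List.mem_of_mem_tail hy))
    subst hxb
    have := hw'.support_nodup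
    rw [← Walk.cons_tail_support, List.nodup_cons] at this
    exact this.1 hy
  · intro v hv
    rw [Walk.mem_support_append_iff] at hv
    exact hv.imp (hs v) (hs' v)

theorem mem_cycleLengths {X : Set V} {a b : V} {l : ℕ} (h : G.HasPathIn X a b l)
    (hba : G.Adj b a) (hl : 2 ≤ l) : l + 1 ∈ G.cycleLengths := by
  obtain ⟨w, hw, rfl, -⟩ := h
  refine ⟨b, .cons hba w, ?_, by simp⟩
  rw [Walk.isCycle_iff_isPath_tail_and_le_length]
  exact ⟨by simpa using hw, by simp; omega⟩

end HasPathIn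

theorem finite_cycleLengths [Finite V] (G : SimpleGraph V) : G.cycleLengths.Finite := by
  have := Fintype.ofFinite V
  refine (Set.finite_Iic (Fintype.card V)).subset ?_
  rintro l ⟨v, c, hc, rfl⟩
  have h := (Walk.isCycle_iff_isPath_tail_and_le_length.1 hc).1.length_lt
  have := c.length_tail_add_one hc.not_nil
  simp only [Set.mem_Iic]
  omega

theorem card_le_ncard_cycleLengths [Finite V] (S : Finset ℕ) (c : ℕ)
    (h : ∀ l ∈ S, l + c ∈ G.cycleLengths) : S.card ≤ G.cycleLengths.ncard := by
  rw [← Set.ncard_coe_finset S]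
  exact Set.ncard_le_ncard_of_injOn (· + c) h (fun _ _ _ _ h => Nat.add_right_cancel h)
    G.finite_cycleLengths

end SimpleGraph

/-! ### Rooted trees: ancestors, meets, distances -/

namespace SimpleGraph

variable {V : Type*} {G : SimpleGraph V}

/-- On the vertex set `S`, the parent function `par` and the depth function `dep` describe a rooted
tree whose edges belong to `G`. -/
structure IsRootedTree (G : SimpleGraph V) (S : Set V) (par : V → V) (dep : V → ℕ) : Prop where
  adj : ∀ x ∈ S, dep x ≠ 0 → G.Adj x (par x)
  par_mem : ∀ x ∈ S, dep x ≠ 0 → par x ∈ S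
  dep_par : ∀ x ∈ S, dep x ≠ 0 → dep (par x) + 1 = dep x
  root_unique : ∀ x ∈ S, ∀ y ∈ S, dep x = 0 → dep y = 0 → x = y

/-- The ancestor of `x` at depth `t`. -/
def ancestor (par : V → V) (dep : V → ℕ) (x : V) (t : ℕ) : V := par^[dep x - t] x

open Classical in
/-- The depth of the last common ancestor of `x` and `y`. -/
noncomputable def meetDepth (par : V → V) (dep : V → ℕ) (x y : V) : ℕ :=
  Nat.findGreatest (fun t => t ≤ dep y ∧ ancestor par dep x t = ancestor par dep y t) (dep x)

/-- The distance of `x` and `y` in a rooted tree. -/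
noncomputable def treeDist (par : V → V) (dep : V → ℕ) (x y : V) : ℕ :=
  dep x + dep y - 2 * meetDepth par dep x y

namespace IsRootedTree

variable {S : Set V} {par : V → V} {dep : V → ℕ} {x y z : V} {t : ℕ}

@[simp] theorem _root_.SimpleGraph.ancestor_self : ancestor par dep x (dep x) = x := by
  simp [ancestor]

theorem ancestor_spec (h : G.IsRootedTree S par dep) (hx : x ∈ S) (k : ℕ) (hk : k ≤ dep x) :
    par^[k] x ∈ S ∧ dep (par^[k] x) + k = dep x := by
  induction k with
  | zero => simpa using hx
  | succ k ih =>
    obtain ⟨h1, h2⟩ := ih (by omega)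
    rw [Function.iterate_succ_apply']
    have h3 : dep (par^[k] x) ≠ 0 := by omega
    have := h.dep_par _ h1 h3
    exact ⟨h.par_mem _ h1 h3, by omega⟩

theorem ancestor_mem (h : G.IsRootedTree S par dep) (hx : x ∈ S) (t : ℕ) :
    ancestor par dep x t ∈ S :=
  (h.ancestor_spec hx _ (by omega)).1

theorem dep_ancestor (h : G.IsRootedTree S par dep) (hx : x ∈ S) (ht : t ≤ dep x) :
    dep (ancestor par dep x t) = t := by
  have := (h.ancestor_spec hx (dep x - t) (by omega)).2
  unfold ancestor
  omega

theorem ancestor_ancestor (h : G.IsRootedTree S par dep) (hx : x ∈ S) {s : ℕ} (hs : s ≤ t)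
    (ht : t ≤ dep x) : ancestor par dep (ancestor par dep x t) s = ancestor par dep x s := by
  have := h.dep_ancestor hx ht
  unfold ancestor at this ⊢
  rw [this, ← Function.iterate_add_apply]
  congr 2
  omega

theorem par_ancestor (ht : t + 1 ≤ dep x) :
    par (ancestor par dep x (t + 1)) = ancestor par dep x t := by
  have : dep x - t = dep x - (t + 1) + 1 := by omega
  rw [ancestor, ancestor, this, Function.iterate_succ_apply']

theorem adj_ancestor (h : G.IsRootedTree S par dep) (hx : x ∈ S) (ht : t + 1 ≤ dep x) :
    G.Adj (ancestor par dep x (t + 1)) (ancestor par dep x t) := by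
  rw [← par_ancestor ht]
  refine h.adj _ (h.ancestor_mem hx _) ?_
  rw [h.dep_ancestor hx ht]
  omega

theorem ancestor_zero (h : G.IsRootedTree S par dep) (hx : x ∈ S) (hy : y ∈ S) :
    ancestor par dep x 0 = ancestor par dep y 0 :=
  h.root_unique _ (h.ancestor_mem hx _) _ (h.ancestor_mem hy _)
    (h.dep_ancestor hx (by omega)) (h.dep_ancestor hy (by omega))

theorem le_meetDepth_iff (h : G.IsRootedTree S par dep) (hx : x ∈ S) (hy : y ∈ S) :
    t ≤ meetDepth par dep x y ↔
      t ≤ dep x ∧ t ≤ dep y ∧ ancestor par dep x t = ancestor par dep y t := by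
  classical
  constructor
  · intro ht
    have h1 : meetDepth par dep x y ≤ dep x := Nat.findGreatest_le _
    obtain ⟨h2, h3⟩ : meetDepth par dep x y ≤ dep y ∧ ancestor par dep x (meetDepth par dep x y) =
        ancestor par dep y (meetDepth par dep x y) := by
      unfold meetDepth
      exact Nat.findGreatest_spec
        (P := fun t => t ≤ dep y ∧ ancestor par dep x t = ancestor par dep y t)
        (Nat.zero_le _) ⟨Nat.zero_le _, h.ancestor_zero hx hy⟩
    refine ⟨ht.trans h1, ht.trans h2, ?_⟩
    rw [← h.ancestor_ancestor hx ht h1, ← h.ancestor_ancestor hy ht h2, h3]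
  · rintro ⟨h1, h2, h3⟩
    exact Nat.le_findGreatest h1 ⟨h2, h3⟩

theorem meetDepth_le_left (h : G.IsRootedTree S par dep) (hx : x ∈ S) (hy : y ∈ S) :
    meetDepth par dep x y ≤ dep x :=
  ((h.le_meetDepth_iff hx hy).1 le_rfl).1

theorem meetDepth_le_right (h : G.IsRootedTree S par dep) (hx : x ∈ S) (hy : y ∈ S) :
    meetDepth par dep x y ≤ dep y :=
  ((h.le_meetDepth_iff hx hy).1 le_rfl).2.1

theorem ancestor_meetDepth (h : G.IsRootedTree S par dep) (hx : x ∈ S) (hy : y ∈ S) :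
    ancestor par dep x (meetDepth par dep x y) = ancestor par dep y (meetDepth par dep x y) :=
  ((h.le_meetDepth_iff hx hy).1 le_rfl).2.2

theorem meetDepth_comm (h : G.IsRootedTree S par dep) (hx : x ∈ S) (hy : y ∈ S) :
    meetDepth par dep x y = meetDepth par dep y x := by
  refine eq_of_forall_le_iff fun t => ?_
  rw [h.le_meetDepth_iff hx hy, h.le_meetDepth_iff hy hx]
  tauto

/-- The ultrametric inequality, from which the four-point condition follows. -/
theorem min_meetDepth_le (h : G.IsRootedTree S par dep) (hx : x ∈ S) (hy : y ∈ S) (hz : z ∈ S) :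
    min (meetDepth par dep x y) (meetDepth par dep y z) ≤ meetDepth par dep x z := by
  obtain ⟨h1, -, h3⟩ := (h.le_meetDepth_iff hx hy).1 (min_le_left _ (meetDepth par dep y z))
  obtain ⟨-, h2, h4⟩ := (h.le_meetDepth_iff hy hz).1 (min_le_right (meetDepth par dep x y) _)
  exact (h.le_meetDepth_iff hx hz).2 ⟨h1, h2, h3.trans h4⟩

/-- The four-point condition for trees. -/
theorem four_point (h : G.IsRootedTree S par dep) {w : V} (hx : x ∈ S) (hy : y ∈ S) (hz : z ∈ S)
    (hw : w ∈ S) :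
    meetDepth par dep x z + meetDepth par dep y w ≤ meetDepth par dep x y + meetDepth par dep z w ∨
    meetDepth par dep x w + meetDepth par dep y z ≤
      meetDepth par dep x y + meetDepth par dep z w := by
  have a1 := h.min_meetDepth_le hx hz hy
  have a2 := h.min_meetDepth_le hx hw hy
  have a3 := h.min_meetDepth_le hz hx hw
  have a4 := h.min_meetDepth_le hz hy hw
  rw [h.meetDepth_comm hz hy] at a1 a4
  rw [h.meetDepth_comm hw hy] at a2
  rw [h.meetDepth_comm hz hx] at a3
  omega

theorem treeDist_add (h : G.IsRootedTree S par dep) (hx : x ∈ S) (hy : y ∈ S) :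
    treeDist par dep x y + 2 * meetDepth par dep x y = dep x + dep y := by
  have := h.meetDepth_le_left hx hy
  have := h.meetDepth_le_right hx hy
  unfold treeDist
  omega

theorem treeDist_pos (h : G.IsRootedTree S par dep) (hx : x ∈ S) (hy : y ∈ S) (hxy : x ≠ y) :
    0 < treeDist par dep x y := by
  have h1 := h.meetDepth_le_left hx hy
  have h2 := h.meetDepth_le_right hx hy
  have h3 := h.treeDist_add hx hy
  have h4 := h.ancestor_meetDepth hx hy
  by_contra h0
  have e1 : meetDepth par dep x y = dep x := by omega
  have e2 : dep x = dep y := by omega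
  rw [e1, ancestor_self, e2, ancestor_self] at h4
  exact hxy h4

theorem hasPathIn_ancestor (h : G.IsRootedTree S par dep) (hx : x ∈ S) (ht : t ≤ dep x) :
    G.HasPathIn {v | ∃ j, t ≤ j ∧ j ≤ dep x ∧ v = ancestor par dep x j} x
      (ancestor par dep x t) (dep x - t) := by
  suffices ∀ k, k + t ≤ dep x →
      G.HasPathIn {v | ∃ j, t ≤ j ∧ j ≤ k + t ∧ v = ancestor par dep x j}
        (ancestor par dep x (k + t)) (ancestor par dep x t) k by
    simpa [ht] using this (dep x - t) (by omega)
  intro k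
  induction k with
  | zero => 
    intro _
    rw [zero_add]
    exact HasPathIn.refl ⟨t, le_rfl, le_rfl, rfl⟩
  | succ k ih =>
    intro hk
    have := HasPathIn.cons (h.adj_ancestor hx (t := k + t) (by omega)) (ih (by omega)) ?_
    · rw [show k + 1 + t = k + t + 1 by ring]
      refine this.mono ?_
      rintro v (rfl | ⟨j, h1, h2, rfl⟩)
      · exact ⟨k + t + 1, by omega, by omega, rfl⟩
      · exact ⟨j, by omega, by omega, rfl⟩
    · rintro ⟨j, h1, h2, h3⟩
      have := congrArg dep h3
      rw [h.dep_ancestor hx (by omega), h.dep_ancestor hx (by omega)] at this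
      omega

theorem hasPathIn_treeDist (h : G.IsRootedTree S par dep) (hx : x ∈ S) (hy : y ∈ S) :
    G.HasPathIn S x y (treeDist par dep x y) := by
  have h1 := h.meetDepth_le_left hx hy
  have h2 := h.meetDepth_le_right hx hy
  have h3 := h.ancestor_meetDepth hx hy
  have p1 := h.hasPathIn_ancestor hx h1
  have p2 := h.hasPathIn_ancestor hy h2
  rw [← h3] at p2
  have h4 : treeDist par dep x y =
      dep x - meetDepth par dep x y + (dep y - meetDepth par dep x y) := by
    unfold treeDist
    omega
  rw [h4]
  refine (p1.append p2.symm ?_).mono ?_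
  · rintro v ⟨j, j1, j2, rfl⟩ ⟨i, i1, i2, hij⟩
    have := congrArg dep hij
    rw [h.dep_ancestor hx (by omega), h.dep_ancestor hy (by omega)] at this
    subst this
    have := (h.le_meetDepth_iff hx hy).2 ⟨j2, i2, hij⟩
    rw [le_antisymm this j1]
  · rintro v (⟨j, -, -, rfl⟩ | ⟨j, -, -, rfl⟩)
    · exact h.ancestor_mem hx _
    · exact h.ancestor_mem hy _

end IsRootedTree

/-! ### Edges between two disjoint trees -/

/-- An upper bound for the number of independent edges between two disjoint trees, the first one
with all degrees at most `q`, when the cycles crossing twice have `s` lengths. -/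
def crossingBound (q : ℕ) : ℕ → ℕ
  | 0 => 1
  | s + 1 => q * crossingBound q s + 1

section Crossing

variable {A B : Set V} {parA parB : V → V} {depA depB : V → ℕ} {β : V → V}

/-- Length, without the two crossing edges, of the cycle through the crossing edges at `x`, `y`. -/
noncomputable def crossingDist (parA : V → V) (depA : V → ℕ) (parB : V → V) (depB : V → ℕ)
    (β : V → V) (x y : V) : ℕ :=
  treeDist parA depA x y + treeDist parB depB (β x) (β y)

open Classical in
/-- The values of `crossingDist` on pairs of distinct elements of `E`. -/
noncomputable def crossingDists (parA : V → V) (depA : V → ℕ) (parB : V → V) (depB : V → ℕ)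
    (β : V → V) (E : Finset V) : Finset ℕ :=
  E.offDiag.image fun e => crossingDist parA depA parB depB β e.1 e.2

theorem mem_crossingDists {E : Finset V} {d : ℕ} :
    d ∈ crossingDists parA depA parB depB β E ↔
      ∃ x ∈ E, ∃ y ∈ E, x ≠ y ∧ crossingDist parA depA parB depB β x y = d := by
  classical
  simp [crossingDists, Finset.mem_offDiag, and_assoc]

/-- Two crossing edges and the tree paths joining their ends form a cycle. The ends in `B` may
coincide: the distinct ends in `A` already give length at least three. -/
theorem crossingDists_card_le [Finite V] (hA : G.IsRootedTree A parA depA)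
    (hB : G.IsRootedTree B parB depB) (hAB : Disjoint A B) (E : Finset V)
    (hE : ∀ x ∈ E, x ∈ A ∧ β x ∈ B ∧ G.Adj x (β x)) :
    (crossingDists parA depA parB depB β E).card ≤ G.cycleLengths.ncard := by
  refine card_le_ncard_cycleLengths _ 2 fun l hl => ?_
  obtain ⟨x, hx, y, hy, hxy, rfl⟩ := mem_crossingDists.1 hl
  obtain ⟨hxA, hxB, hxx⟩ := hE x hx
  obtain ⟨hyA, hyB, hyy⟩ := hE y hy
  have p1 := (hB.hasPathIn_treeDist hxB hyB).cons hxx (fun h => hAB.le_bot ⟨hxA, h⟩)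
  have p2 := (hA.hasPathIn_treeDist hxA hyA).symm.append p1 (by
    rintro v hv (rfl | hv')
    · rfl
    · exact (hAB.le_bot ⟨hv, hv'⟩).elim)
  have := hA.treeDist_pos hxA hyA hxy
  have := p2.mem_cycleLengths hyy.symm (by omega)
  unfold crossingDist
  convert this using 1
  ring

/-- The induction removes the largest crossing distance. Among the pairs attaining it, take one
whose meeting point `c` in the first tree is deepest. Deleting `c` leaves at most `q` parts, none
containing a pair at maximum distance; `c` itself accounts for the added 1. -/
theorem card_le_crossingBound (hA : G.IsRootedTree A parA depA)
    (hB : G.IsRootedTree B parB depB) {q : ℕ}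
    (hq : ∀ c ∈ A, ∀ Y : Finset V, (∀ x ∈ Y, x ∈ A ∧ depA x ≠ 0 ∧ parA x = c) →
      Y.card + (if depA c = 0 then 0 else 1) ≤ q) (s : ℕ) :
    ∀ E : Finset V, (∀ x ∈ E, x ∈ A ∧ β x ∈ B) →
      (crossingDists parA depA parB depB β E).card ≤ s → E.card ≤ crossingBound q s := by
  classical
  set Dist := crossingDist parA depA parB depB β with hDist
  induction s with
  | zero =>
    intro E hE hs
    rw [Nat.le_zero, Finset.card_eq_zero, Finset.eq_empty_iff_forall_notMem] at hs
    rw [crossingBound, Finset.card_le_one]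
    intro x hx y hy
    by_contra hxy
    exact hs _ (mem_crossingDists.2 ⟨x, hx, y, hy, hxy, rfl⟩)
  | succ s ih =>
    intro E hE hs
    rw [crossingBound]
    rcases Nat.lt_or_ge 1 E.card with h1 | h1
    swap
    · omega
    have hoff : E.offDiag.Nonempty := by
      obtain ⟨x, hx, y, hy, hxy⟩ := Finset.one_lt_card.1 h1
      exact ⟨(x, y), by simp [*]⟩
    obtain ⟨e, he, hmax⟩ := E.offDiag.exists_max_image (fun e => Dist e.1 e.2) hoff
    set D := Dist e.1 e.2 with hD
    have hle : ∀ x ∈ E, ∀ y ∈ E, x ≠ y → Dist x y ≤ D := fun x hx y hy hxy =>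
      hmax (x, y) (by simp [*])
    have hne : (E.offDiag.filter fun e => Dist e.1 e.2 = D).Nonempty := ⟨e, by simp_all⟩
    obtain ⟨⟨i, j⟩, hij, hdeep⟩ := Finset.exists_max_image _
      (fun e => meetDepth parA depA e.1 e.2) hne
    simp only [Finset.mem_filter, Finset.mem_offDiag] at hij
    obtain ⟨⟨hi, hj, hij⟩, hijD⟩ := hij
    have hdeep' : ∀ x ∈ E, ∀ y ∈ E, x ≠ y → Dist x y = D →
        meetDepth parA depA x y ≤ meetDepth parA depA i j := fun x hx y hy hxy h =>
      hdeep (x, y) (Finset.mem_filter.2 ⟨Finset.mem_offDiag.2 ⟨hx, hy, hxy⟩, h⟩)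
    set m := meetDepth parA depA i j with hm
    set c := ancestor parA depA i m with hc
    have hcA : c ∈ A := hA.ancestor_mem (hE i hi).1 m
    have hdc : depA c = m := hA.dep_ancestor (hE i hi).1 (hA.meetDepth_le_left (hE i hi).1 (hE j hj).1)
    have small : ∀ F ⊆ E, (∀ x ∈ F, ∀ y ∈ F, x ≠ y → Dist x y ≠ D) →
        F.card ≤ crossingBound q s := by
      intro F hF hFD
      refine ih F (fun x hx => hE x (hF hx)) ?_
      have : crossingDists parA depA parB depB β F ⊂ crossingDists parA depA parB depB β E := by
        rw [Finset.ssubset_iff_of_subset]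
        · refine ⟨D, mem_crossingDists.2 ⟨i, hi, j, hj, hij, hijD⟩, fun h => ?_⟩
          obtain ⟨x, hx, y, hy, hxy, h⟩ := mem_crossingDists.1 h
          exact hFD x hx y hy hxy h
        · intro d hd
          obtain ⟨x, hx, y, hy, hxy, h⟩ := mem_crossingDists.1 hd
          exact mem_crossingDists.2 ⟨x, hF hx, y, hF hy, hxy, h⟩
      have := Finset.card_lt_card this
      omega
    set E₀ := E.filter fun x => meetDepth parA depA i x < m with hE₀
    set E₁ := E.filter fun x => m ≤ meetDepth parA depA i x ∧ x ≠ c with hE₁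
    have hcover : E ⊆ insert c (E₀ ∪ E₁) := by
      intro x hx
      simp only [hE₀, hE₁, Finset.mem_insert, Finset.mem_union, Finset.mem_filter]
      by_cases h : x = c
      · exact .inl h
      · rcases lt_or_ge (meetDepth parA depA i x) m with h' | h'
        · exact .inr (.inl ⟨hx, h'⟩)
        · exact .inr (.inr ⟨hx, h', h⟩)
    have hE₀small : E₀.card ≤ crossingBound q s * (if depA c = 0 then 0 else 1) := by
      split_ifs with h0
      · rw [hdc] at h0
        simp [hE₀, h0]
      rw [mul_one]
      refine small _ (Finset.filter_subset _ _) ?_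
      intro k hk l hl hkl hD'
      rw [hE₀, Finset.mem_filter] at hk hl
      obtain ⟨hk, hkm⟩ := hk
      obtain ⟨hl, hlm⟩ := hl
      have iA := (hE i hi).1
      have jA := (hE j hj).1
      have kA := (hE k hk).1
      have lA := (hE l hl).1
      have iB := (hE i hi).2
      have jB := (hE j hj).2
      have kB := (hE k hk).2
      have lB := (hE l hl).2
      have hji := hA.meetDepth_comm iA jA
      have hki := hA.meetDepth_comm iA kA
      have hkj := hA.meetDepth_comm jA kA
      have u1 := hA.min_meetDepth_le iA jA kA
      have u2 := hA.min_meetDepth_le jA iA kA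
      have u3 := hA.min_meetDepth_le iA jA lA
      have u4 := hA.min_meetDepth_le jA iA lA
      have u5 := hA.min_meetDepth_le kA iA lA
      have hik : i ≠ k := by
        rintro rfl
        have := hA.meetDepth_le_left iA jA
        have := (hA.le_meetDepth_iff (t := depA i) iA iA).2 ⟨le_rfl, le_rfl, rfl⟩
        omega
      have hil : i ≠ l := by
        rintro rfl
        have := hA.meetDepth_le_left iA jA
        have := (hA.le_meetDepth_iff (t := depA i) iA iA).2 ⟨le_rfl, le_rfl, rfl⟩
        omega
      have hjk : j ≠ k := by
        rintro rfl
        omega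
      have hjl : j ≠ l := by
        rintro rfl
        omega
      have d1 := hle i hi k hk hik
      have d2 := hle j hj l hl hjl
      have d3 := hle i hi l hl hil
      have d4 := hle j hj k hk hjk
      simp only [hDist, crossingDist] at d1 d2 d3 d4 hD' hijD
      have a1 := hA.treeDist_add iA kA
      have a2 := hA.treeDist_add jA lA
      have a3 := hA.treeDist_add iA lA
      have a4 := hA.treeDist_add jA kA
      have a5 := hA.treeDist_add iA jA
      have a6 := hA.treeDist_add kA lA
      have b1 := hB.treeDist_add iB kB
      have b2 := hB.treeDist_add jB lB
      have b3 := hB.treeDist_add iB lB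
      have b4 := hB.treeDist_add jB kB
      have b5 := hB.treeDist_add iB jB
      have b6 := hB.treeDist_add kB lB
      -- In the first tree `c` separates `i`, `j` from `k`, `l`, so both ways of exchanging partners
      -- strictly increase the total distance. By the four-point condition one of them loses nothing
      -- in the second tree, and its total exceeds `2 * D`.
      have fp := hB.four_point iB jB kB lB
      omega
    have hE₁small : ∃ Y : Finset V, (∀ x ∈ Y, x ∈ A ∧ depA x ≠ 0 ∧ parA x = c) ∧
        E₁.card ≤ crossingBound q s * Y.card := by
      have key : ∀ x ∈ E₁, m + 1 ≤ depA x ∧ ancestor parA depA x m = c := by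
        intro x hx
        rw [hE₁, Finset.mem_filter] at hx
        obtain ⟨hx, hxm, hxc⟩ := hx
        obtain ⟨-, h2, h3⟩ := (hA.le_meetDepth_iff (hE i hi).1 (hE x hx).1).1 hxm
        refine ⟨?_, h3.symm⟩
        by_contra h4
        have h5 : m = depA x := by omega
        rw [← hc, h5, ancestor_self] at h3
        exact hxc h3.symm
      refine ⟨E₁.image fun x => ancestor parA depA x (m + 1), ?_, ?_⟩
      · intro y hy
        obtain ⟨x, hx, rfl⟩ := Finset.mem_image.1 hy
        have hxA := (hE x (Finset.filter_subset _ _ hx)).1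
        obtain ⟨h1, h2⟩ := key x hx
        refine ⟨hA.ancestor_mem hxA _, ?_, ?_⟩
        · rw [hA.dep_ancestor hxA h1]
          omega
        · rw [IsRootedTree.par_ancestor (par := parA) h1, h2]
      · refine Finset.card_le_mul_card_image _ _ fun y _ => small _ ?_ ?_
        · exact (Finset.filter_subset _ _).trans (Finset.filter_subset _ _)
        · intro k hk l hl hkl hD'
          rw [Finset.mem_filter] at hk hl
          have hkE := Finset.filter_subset _ _ hk.1
          have hlE := Finset.filter_subset _ _ hl.1
          -- Such a pair would meet at a child of `c` or deeper, against the choice of `i`, `j`.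
          have := hdeep' k hkE l hlE hkl hD'
          have := (hA.le_meetDepth_iff (hE k hkE).1 (hE l hlE).1).2
            ⟨(key k hk.1).1, (key l hl.1).1, hk.2.trans hl.2.symm⟩
          omega
    obtain ⟨Y, hY, hYc⟩ := hE₁small
    have h2 := hq c hcA Y hY
    have h3 := Finset.card_le_card hcover
    have h4 := Finset.card_insert_le c (E₀ ∪ E₁)
    have h5 := Finset.card_union_le E₀ E₁
    have h6 := Nat.mul_le_mul_left (crossingBound q s) h2
    rw [mul_add] at h6
    rw [mul_comm q]
    omega

/-- Two disjoint trees in a graph with few cycle lengths are joined by few independent edges. -/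
theorem IsRootedTree.card_le_crossingBound [Finite V] (hA : G.IsRootedTree A parA depA)
    (hB : G.IsRootedTree B parB depB) (hAB : Disjoint A B) {q : ℕ}
    (hq : ∀ c ∈ A, ∀ Y : Finset V, (∀ x ∈ Y, x ∈ A ∧ depA x ≠ 0 ∧ parA x = c) →
      Y.card + (if depA c = 0 then 0 else 1) ≤ q) (E : Finset V)
    (hE : ∀ x ∈ E, x ∈ A ∧ β x ∈ B ∧ G.Adj x (β x)) :
    E.card ≤ crossingBound q G.cycleLengths.ncard :=
  SimpleGraph.card_le_crossingBound hA hB hq _ E (fun x hx => ⟨(hE x hx).1, (hE x hx).2.1⟩)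
    (crossingDists_card_le hA hB hAB E hE)

end Crossing

end SimpleGraph

/-! ### Ear systems along a path -/

namespace SimpleGraph

variable {V : Type*} {G : SimpleGraph V}

/-- A path `y 0, …, y R` where each `y d` with `2 ≤ d` starts an ear `y d, b d, …, y (μ d)` whose
other vertices lie in `F (μ d)`, with `F 0, F 1, …` disjoint from each other and from the path. -/
structure IsEarSystem (G : SimpleGraph V) (R : ℕ) (y : ℕ → V) (F : ℕ → Set V) (μ : ℕ → ℕ)
    (b : ℕ → V) (h : ℕ → ℕ) : Prop where
  inj : ∀ i ≤ R, ∀ j ≤ R, y i = y j → i = j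
  adj : ∀ i < R, G.Adj (y (i + 1)) (y i)
  notMem : ∀ i ≤ R, ∀ j, y i ∉ F j
  disj : ∀ i j v, v ∈ F i → v ∈ F j → i = j
  ear_lt : ∀ d, 2 ≤ d → d ≤ R → μ d + 2 ≤ d
  ear_adj : ∀ d, 2 ≤ d → d ≤ R → G.Adj (y d) (b d)
  ear_path : ∀ d, 2 ≤ d → d ≤ R → G.HasPathIn (insert (y (μ d)) (F (μ d))) (b d) (y (μ d)) (h d)

namespace IsEarSystem

variable {R : ℕ} {y : ℕ → V} {F : ℕ → Set V} {μ : ℕ → ℕ} {b : ℕ → V} {h : ℕ → ℕ}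

theorem seg (hE : G.IsEarSystem R y F μ b h) {i j : ℕ} (hij : i ≤ j) (hj : j ≤ R) :
    G.HasPathIn {v | ∃ t, i ≤ t ∧ t ≤ j ∧ v = y t} (y i) (y j) (j - i) := by
  induction j, hij using Nat.le_induction with
  | base =>
    rw [Nat.sub_self]
    exact HasPathIn.refl ⟨i, le_rfl, le_rfl, rfl⟩
  | succ j hij ih =>
    have := (ih (by omega)).symm.cons (hE.adj j (by omega)) ?_
    · rw [show j + 1 - i = j - i + 1 by omega]
      refine this.symm.mono ?_
      rintro v (rfl | ⟨t, h1, h2, rfl⟩)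
      · exact ⟨j + 1, by omega, by omega, rfl⟩
      · exact ⟨t, by omega, by omega, rfl⟩
    · rintro ⟨t, h1, h2, h3⟩
      have := hE.inj _ hj _ (by omega) h3
      omega

theorem ear (hE : G.IsEarSystem R y F μ b h) {d : ℕ} (h2 : 2 ≤ d) (hd : d ≤ R) :
    G.HasPathIn (insert (y d) (insert (y (μ d)) (F (μ d)))) (y d) (y (μ d)) (h d + 1) := by
  refine (hE.ear_path d h2 hd).cons (hE.ear_adj d h2 hd) ?_
  have := hE.ear_lt d h2 hd
  rintro (h | h)
  · have := hE.inj _ hd _ (by omega) h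
    omega
  · exact hE.notMem _ hd _ h

/-- The part of an ear system between positions `r` and `r'`. -/
def region (y : ℕ → V) (F : ℕ → Set V) (r r' : ℕ) : Set V :=
  {v | (∃ t, r ≤ t ∧ t ≤ r' ∧ v = y t) ∨ ∃ t, r ≤ t ∧ t < r' ∧ v ∈ F t}

/-- Follow the ear of `y (m + 1)` backwards from its foot, then the given path backwards to `y m`,
then descend along the `y` path to just above the foot. The new path is strictly longer and its ends
are again consecutive, so one edge closes it to a cycle. -/
theorem chain_step (hE : G.IsEarSystem R y F μ b h) {m L : ℕ} (hm : 1 ≤ m) (hmR : m + 1 ≤ R)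
    (hp : G.HasPathIn (region y F m R) (y m) (y (m + 1)) L) :
    ∃ L', L < L' ∧ G.HasPathIn (region y F (μ (m + 1)) R) (y (μ (m + 1)))
      (y (μ (m + 1) + 1)) L' := by
  have hlt := hE.ear_lt (m + 1) (by omega) hmR
  have p1 := (hE.seg (i := μ (m + 1) + 1) (j := m) (by omega) (by omega)).append hp (by
    rintro _ ⟨t, h1, h2, rfl⟩ (⟨s, h3, h4, h5⟩ | ⟨s, h3, h4, h5⟩)
    · have := hE.inj _ (by omega) _ (by omega) h5
      rw [show t = m by omega]
    · exact (hE.notMem _ (by omega) _ h5).elim)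
  have p2 := p1.append (hE.ear (d := m + 1) (by omega) hmR) (by
    rintro v hv (rfl | rfl | hv')
    · rfl
    · obtain ⟨t, h1, h2, h3⟩ | ⟨t, h3, h4, h5⟩ | ⟨t, h3, h4, h5⟩ := hv
      · have := hE.inj _ (by omega) _ (by omega) h3
        omega
      · have := hE.inj _ (by omega) _ (by omega) h5
        omega
      · exact (hE.notMem _ (by omega) _ h5).elim
    · obtain ⟨t, h1, h2, rfl⟩ | ⟨t, h3, h4, rfl⟩ | ⟨t, h3, h4, h5⟩ := hv
      · exact (hE.notMem _ (by omega) _ hv').elim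
      · exact (hE.notMem _ (by omega) _ hv').elim
      · have := hE.disj _ _ _ hv' h5
        omega)
  refine ⟨_, ?_, p2.symm.mono ?_⟩
  · omega
  · rintro v ((⟨t, h1, h2, rfl⟩ | ⟨t, h1, h2, rfl⟩ | ⟨t, h1, h2, h3⟩) | (rfl | rfl | hv))
    · exact .inl ⟨t, by omega, by omega, rfl⟩
    · exact .inl ⟨t, by omega, by omega, rfl⟩
    · exact .inr ⟨t, by omega, by omega, h3⟩
    · exact .inl ⟨m + 1, by omega, by omega, rfl⟩
    · exact .inl ⟨_, le_rfl, by omega, rfl⟩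
    · exact .inr ⟨_, le_rfl, by omega, hv⟩

theorem chain_base (hE : G.IsEarSystem R y F μ b h) (hR : 2 ≤ R) :
    ∃ L, 2 ≤ L ∧ G.HasPathIn (region y F (μ R) R) (y (μ R)) (y (μ R + 1)) L := by
  have hlt := hE.ear_lt R hR le_rfl
  have p := (hE.seg (i := μ R + 1) (j := R) (by omega) le_rfl).append (hE.ear hR le_rfl) (by
    rintro _ ⟨t, h1, h2, rfl⟩ (h3 | h3 | h3)
    · exact h3
    · have := hE.inj _ (by omega) _ (by omega) h3
      omega
    · exact (hE.notMem _ (by omega) _ h3).elim)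
  refine ⟨_, ?_, p.symm.mono ?_⟩
  · omega
  · rintro v (⟨t, h1, h2, rfl⟩ | (rfl | rfl | hv))
    · exact .inl ⟨t, by omega, by omega, rfl⟩
    · exact .inl ⟨_, by omega, le_rfl, rfl⟩
    · exact .inl ⟨_, le_rfl, by omega, rfl⟩
    · exact .inr ⟨_, le_rfl, by omega, hv⟩

/-- If all ears are short, many ears in a chain give many cycle lengths. -/
theorem le_mul_of_ear_le [Finite V] (hE : G.IsEarSystem R y F μ b h) (hR : 2 ≤ R) {g : ℕ}
    (hg : ∀ d, 2 ≤ d → d ≤ R → d ≤ μ d + g) : R ≤ (G.cycleLengths.ncard + 1) * g := by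
  by_contra! hlt
  -- Each link of the chain lowers `m` by at most `g`, so a longer path would leave room for one
  -- cycle length too many.
  have key : ∀ k ≤ G.cycleLengths.ncard, ∃ (m L : ℕ) (S : Finset ℕ), m + 1 ≤ R ∧
      R ≤ m + (k + 1) * g ∧ 2 ≤ L ∧ G.HasPathIn (region y F m R) (y m) (y (m + 1)) L ∧
      S.card = k + 1 ∧ ∀ l ∈ S, l ≤ L ∧ l + 1 ∈ G.cycleLengths := by
    intro k
    induction k with
    | zero =>
      intro _
      obtain ⟨L, hL, hp⟩ := hE.chain_base hR
      have h1 := hE.ear_lt R hR le_rfl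
      have h2 := hg R hR le_rfl
      refine ⟨μ R, L, {L}, by omega, by omega, hL, hp, by simp, ?_⟩
      simp only [Finset.mem_singleton, forall_eq]
      exact ⟨le_rfl, hp.mem_cycleLengths (hE.adj _ (by omega)) hL⟩
    | succ k ih =>
      intro hk
      obtain ⟨m, L, S, h1, h2, h3, h4, h5, h6⟩ := ih (by omega)
      have h7 : (k + 1) * g ≤ (G.cycleLengths.ncard + 1) * g := Nat.mul_le_mul_right _ (by omega)
      have hm : 1 ≤ m := by omega
      obtain ⟨L', hL', hp'⟩ := hE.chain_step hm h1 h4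
      have h8 := hE.ear_lt (m + 1) (by omega) h1
      have h9 := hg (m + 1) (by omega) h1
      refine ⟨μ (m + 1), L', insert L' S, by omega, ?_, by omega, hp', ?_, ?_⟩
      · have : (k + 1 + 1) * g = (k + 1) * g + g := by ring
        omega
      · rw [Finset.card_insert_of_notMem, h5]
        intro h
        have := (h6 _ h).1
        omega
      · intro l hl
        rcases Finset.mem_insert.1 hl with rfl | hl
        · exact ⟨le_rfl, hp'.mem_cycleLengths (hE.adj _ (by omega)) (by omega)⟩
        · exact ⟨(h6 l hl).1.trans hL'.le, (h6 l hl).2⟩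
  obtain ⟨_, _, S, -, -, -, -, h1, h2⟩ := key _ le_rfl
  have := card_le_ncard_cycleLengths S 1 fun l hl => (h2 l hl).2
  omega

/-- There are four routes: straight, via either ear, or via both ears with the edge between `y (μ a
+ 1)` and `y (μ a)` traversed downwards. If each ear is as long as the segment it bypasses, the last
route is longer than the straight one by 2, as that edge is counted thrice. -/
theorem gadget (hE : G.IsEarSystem R y F μ b h) {a : ℕ} (ha : 2 ≤ a) (haR : a ≤ R)
    (hm : 1 ≤ μ a) : ∃ l l', l < l' ∧
      G.HasPathIn (region y F (μ (μ a + 1)) a) (y (μ (μ a + 1))) (y a) l ∧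
      G.HasPathIn (region y F (μ (μ a + 1)) a) (y (μ (μ a + 1))) (y a) l' := by
  have hlt := hE.ear_lt a ha haR
  have hlt' := hE.ear_lt (μ a + 1) (by omega) (by omega)
  have earA := hE.ear ha haR
  have earB := hE.ear (d := μ a + 1) (by omega) (by omega)
  set m := μ a
  set c := μ (m + 1)
  have segsub : ∀ i j, c ≤ i → j ≤ a → {v | ∃ t, i ≤ t ∧ t ≤ j ∧ v = y t} ⊆ region y F c a := by
    rintro i j hi hj v ⟨t, h1, h2, rfl⟩
    exact .inl ⟨t, by omega, by omega, rfl⟩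
  have earAsub : insert (y a) (insert (y m) (F m)) ⊆ region y F c a := by
    rintro v (rfl | rfl | hv)
    · exact .inl ⟨a, by omega, by omega, rfl⟩
    · exact .inl ⟨m, by omega, by omega, rfl⟩
    · exact .inr ⟨m, by omega, by omega, hv⟩
  have earBsub : insert (y (m + 1)) (insert (y c) (F c)) ⊆ region y F c a := by
    rintro v (rfl | rfl | hv)
    · exact .inl ⟨m + 1, by omega, by omega, rfl⟩
    · exact .inl ⟨c, by omega, by omega, rfl⟩
    · exact .inr ⟨c, by omega, by omega, hv⟩
  have direct := (hE.seg (i := c) (j := a) (by omega) haR).mono (segsub _ _ le_rfl le_rfl)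
  have viaA := ((hE.seg (i := c) (j := m) (by omega) (by omega)).append earA.symm (by
    rintro _ ⟨t, h1, h2, rfl⟩ (h3 | h3 | h3)
    · have := hE.inj _ (by omega) _ (by omega) h3
      omega
    · exact h3
    · exact (hE.notMem _ (by omega) _ h3).elim)).mono
    (Set.union_subset (segsub _ _ le_rfl (by omega)) earAsub)
  have viaB := (earB.symm.append (hE.seg (i := m + 1) (j := a) (by omega) (by omega)) (by
    rintro _ (rfl | rfl | h3) ⟨t, h1, h2, h4⟩
    · rfl
    · have := hE.inj _ (by omega) _ (by omega) h4
      omega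
    · exact (hE.notMem t (by omega) c (h4 ▸ h3)).elim)).mono
    (Set.union_subset earBsub (segsub _ _ (by omega) le_rfl))
  have edge := (hE.seg (i := m) (j := m + 1) (by omega) (by omega)).symm
  have zigzag := ((earB.symm.append edge (by
    rintro _ (rfl | rfl | h3) ⟨t, h1, h2, h4⟩
    · rfl
    · have := hE.inj _ (by omega) _ (by omega) h4
      omega
    · exact (hE.notMem t (by omega) c (h4 ▸ h3)).elim)).append earA.symm (by
    rintro v hv (rfl | rfl | h3)
    · obtain (h4 | h4 | h4) | ⟨t, h1, h2, h4⟩ := hv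
      · have := hE.inj _ (by omega) _ (by omega) h4
        omega
      · have := hE.inj _ (by omega) _ (by omega) h4
        omega
      · exact (hE.notMem _ (by omega) _ h4).elim
      · have := hE.inj _ (by omega) _ (by omega) h4
        omega
    · rfl
    · obtain (rfl | rfl | h4) | ⟨t, h1, h2, rfl⟩ := hv
      · exact (hE.notMem _ (by omega) _ h3).elim
      · exact (hE.notMem _ (by omega) _ h3).elim
      · have := hE.disj _ _ _ h3 h4
        omega
      · exact (hE.notMem _ (by omega) _ h3).elim)).mono
    (Set.union_subset (Set.union_subset earBsub (segsub _ _ (by omega) (by omega))) earAsub)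
  have pick : ∀ {l l'}, G.HasPathIn (region y F c a) (y c) (y a) l →
      G.HasPathIn (region y F c a) (y c) (y a) l' → l ≠ l' → ∃ l l', l < l' ∧
      G.HasPathIn (region y F c a) (y c) (y a) l ∧ G.HasPathIn (region y F c a) (y c) (y a) l' := by
    intro l l' h1 h2 hne
    rcases Nat.lt_or_gt_of_ne hne with h | h
    · exact ⟨l, l', h, h1, h2⟩
    · exact ⟨l', l, h, h2, h1⟩
  by_cases hA : h a + 1 = a - m
  · by_cases hB : h (m + 1) + 1 = m + 1 - c
    · exact pick direct zigzag (by omega)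
    · exact pick direct viaB (by omega)
  · exact pick direct viaA (by omega)

/-- Like `region`, without the attachments at the lower end. -/
def upperRegion (y : ℕ → V) (F : ℕ → Set V) (r r' : ℕ) : Set V :=
  {v | (∃ t, r ≤ t ∧ t ≤ r' ∧ v = y t) ∨ ∃ t, r < t ∧ t ≤ r' ∧ v ∈ F t}

theorem append_upperRegion (hE : G.IsEarSystem R y F μ b h) {r₁ r₂ r₃ l l' : ℕ}
    (h₁₂ : r₁ ≤ r₂) (h₂₃ : r₂ ≤ r₃) (h₃ : r₃ ≤ R)
    (hp : G.HasPathIn (upperRegion y F r₁ r₂) (y r₁) (y r₂) l)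
    (hp' : G.HasPathIn (upperRegion y F r₂ r₃) (y r₂) (y r₃) l') :
    G.HasPathIn (upperRegion y F r₁ r₃) (y r₁) (y r₃) (l + l') := by
  refine (hp.append hp' ?_).mono ?_
  · rintro v (⟨t, h1, h2, rfl⟩ | ⟨t, h1, h2, h3⟩) (⟨s, h4, h5, h6⟩ | ⟨s, h4, h5, h6⟩)
    · have := hE.inj _ (by omega) _ (by omega) h6
      rw [show t = r₂ by omega]
    · exact (hE.notMem _ (by omega) _ h6).elim
    · exact (hE.notMem s (by omega) t (h6 ▸ h3)).elim
    · have := hE.disj _ _ _ h3 h6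
      omega
  · rintro v ((⟨t, h1, h2, h3⟩ | ⟨t, h1, h2, h3⟩) | (⟨t, h1, h2, h3⟩ | ⟨t, h1, h2, h3⟩))
    · exact .inl ⟨t, by omega, by omega, h3⟩
    · exact .inr ⟨t, by omega, by omega, h3⟩
    · exact .inl ⟨t, by omega, by omega, h3⟩
    · exact .inr ⟨t, by omega, by omega, h3⟩

theorem seg_upperRegion (hE : G.IsEarSystem R y F μ b h) {i j : ℕ} (hij : i ≤ j) (hj : j ≤ R) :
    G.HasPathIn (upperRegion y F i j) (y i) (y j) (j - i) :=
  (hE.seg hij hj).mono fun _ hv => .inl hv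

/-- A stretch of the path that is long compared to the number of ears over each position contains
two overlapping ears, hence can be traversed with two different lengths. -/
theorem block (hE : G.IsEarSystem R y F μ b h) {H r : ℕ}
    (hH : ∀ r, ((Finset.Icc 2 R).filter fun d => r < d ∧ μ d ≤ r).card ≤ H)
    (hr : r + (H + H * H + 2) ≤ R) : ∃ l l', l < l' ∧
      G.HasPathIn (upperRegion y F r (r + (H + H * H + 2))) (y r) (y (r + (H + H * H + 2))) l ∧
      G.HasPathIn (upperRegion y F r (r + (H + H * H + 2))) (y r) (y (r + (H + H * H + 2))) l' := by
  classical
  set M := H + H * H + 2 with hM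
  -- There are `H + H * H + 1` candidates `a`. One fails only if its ear passes over `r`, or if the
  -- ear of `d = μ a + 1` does. In the latter case the ear of `a` passes over `d - 1`, so at most `H
  -- + H * H` candidates fail.
  obtain ⟨a, ha, h1, h2⟩ : ∃ a ∈ Finset.Icc (r + 2) (r + M), r < μ a ∧ r < μ (μ a + 1) := by
    by_contra! hcon
    set C : ℕ → Finset ℕ := fun r => (Finset.Icc 2 R).filter fun d => r < d ∧ μ d ≤ r with hC
    have hsub : Finset.Icc (r + 2) (r + M) ⊆ C r ∪ (C r).biUnion fun d => C (d - 1) := by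
      intro a ha
      have hcon := hcon a ha
      rw [Finset.mem_Icc] at ha
      have := hE.ear_lt a (by omega) (by omega)
      simp only [hC, Finset.mem_union, Finset.mem_biUnion, Finset.mem_filter, Finset.mem_Icc]
      rcases Nat.lt_or_ge r (μ a) with h | h
      · refine .inr ⟨μ a + 1, ⟨⟨by omega, by omega⟩, by omega, hcon h⟩, ⟨by omega, by omega⟩, ?_, ?_⟩
        · omega
        · omega
      · exact .inl ⟨⟨by omega, by omega⟩, by omega, h⟩
    have h1 := Finset.card_le_card hsub
    have h2 := Finset.card_union_le (C r) ((C r).biUnion fun d => C (d - 1))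
    have h3 := Finset.card_biUnion_le_card_mul (C r) (fun d => C (d - 1)) H fun d _ => hH _
    have h4 := Nat.mul_le_mul_right H (hH r)
    have h5 := hH r
    rw [Nat.card_Icc] at h1
    simp only [hC] at h1 h2 h3
    omega
  rw [Finset.mem_Icc] at ha
  have hlt := hE.ear_lt a (by omega) (by omega)
  have hlt' := hE.ear_lt (μ a + 1) (by omega) (by omega)
  obtain ⟨l, l', hll, p, p'⟩ := hE.gadget (a := a) (by omega) (by omega) (by omega)
  have build : ∀ l, G.HasPathIn (region y F (μ (μ a + 1)) a) (y (μ (μ a + 1))) (y a) l →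
      G.HasPathIn (upperRegion y F r (r + M)) (y r) (y (r + M))
        (μ (μ a + 1) - r + l + (r + M - a)) := by
    intro l p
    refine (((hE.seg (i := r) (j := μ (μ a + 1)) (by omega) (by omega)).append p ?_).append
      (hE.seg (i := a) (j := r + M) (by omega) (by omega)) ?_).mono ?_
    · rintro _ ⟨t, h1, h2, rfl⟩ (⟨s, h4, h5, h6⟩ | ⟨s, h4, h5, h6⟩)
      · have := hE.inj _ (by omega) _ (by omega) h6
        rw [show t = μ (μ a + 1) by omega]
      · exact (hE.notMem _ (by omega) _ h6).elim
    · rintro v (⟨t, h1, h2, rfl⟩ | ⟨t, h1, h2, rfl⟩ | ⟨t, h1, h2, h3⟩) ⟨s, h4, h5, h6⟩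
      · have := hE.inj _ (by omega) _ (by omega) h6
        omega
      · have := hE.inj _ (by omega) _ (by omega) h6
        rw [show t = a by omega]
      · exact (hE.notMem s (by omega) t (h6 ▸ h3)).elim
    · rintro v ((⟨t, h1, h2, h3⟩ | ⟨t, h1, h2, h3⟩ | ⟨t, h1, h2, h3⟩) | ⟨t, h1, h2, h3⟩)
      · exact .inl ⟨t, by omega, by omega, h3⟩
      · exact .inl ⟨t, by omega, by omega, h3⟩
      · exact .inr ⟨t, by omega, by omega, h3⟩
      · exact .inl ⟨t, by omega, by omega, h3⟩
  exact ⟨_, _, by omega, build l p, build l' p'⟩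

/-- If few ears pass over each position, there is no long ear. -/
theorem ear_le_of_congestion_le [Finite V] (hE : G.IsEarSystem R y F μ b h) {H : ℕ}
    (hH : ∀ r, ((Finset.Icc 2 R).filter fun d => r < d ∧ μ d ≤ r).card ≤ H) {d : ℕ}
    (hd : 2 ≤ d) (hdR : d ≤ R) :
    d ≤ μ d + (G.cycleLengths.ncard + 1) * (H + H * H + 2) := by
  classical
  by_contra! hlt
  set M := H + H * H + 2 with hM
  -- Every block offers two lengths, and adding a two-element set to `S` enlarges it by at least
  -- one. The bound `k ≤ l` ensures that the final closed walk is long enough to be a cycle.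
  have key : ∀ k, μ d + k * M < d → ∃ S : Finset ℕ, k + 1 ≤ S.card ∧ ∀ l ∈ S,
      G.HasPathIn (upperRegion y F (μ d) (μ d + k * M)) (y (μ d)) (y (μ d + k * M)) l ∧ k ≤ l := by
    intro k
    induction k with
    | zero =>
      intro _
      refine ⟨{0}, by simp, ?_⟩
      simpa using hE.seg_upperRegion (i := μ d) le_rfl (by omega)
    | succ k ih =>
      intro hk
      rw [show μ d + (k + 1) * M = μ d + k * M + M by ring] at hk ⊢
      obtain ⟨S, hS, hp⟩ := ih (by omega)
      obtain ⟨l, l', hll, p, p'⟩ := hE.block (r := μ d + k * M) hH (by omega)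
      have hne : S.Nonempty := by
        rw [← Finset.card_pos]
        omega
      have hl : 1 ≤ l := by
        rcases Nat.eq_zero_or_pos l with rfl | h0
        · obtain ⟨w, -, hw, -⟩ := p
          have := hE.inj _ (by omega) _ (by omega) (Walk.eq_of_length_eq_zero hw)
          omega
        · exact h0
      refine ⟨insert (S.max' hne + l') (S.image (· + l)), ?_, ?_⟩
      · rw [Finset.card_insert_of_notMem, Finset.card_image_of_injective _ (add_left_injective l)]
        · omega
        · rw [Finset.mem_image]
          rintro ⟨x, hx, h1⟩
          have := S.le_max' x hx
          omega
      · intro x hx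
        rcases Finset.mem_insert.1 hx with rfl | hx
        · obtain ⟨h1, h2⟩ := hp _ (S.max'_mem hne)
          exact ⟨hE.append_upperRegion (by omega) (by omega) (by omega) h1 p', by omega⟩
        · obtain ⟨z, hz, rfl⟩ := Finset.mem_image.1 hx
          obtain ⟨h1, h2⟩ := hp z hz
          exact ⟨hE.append_upperRegion (by omega) (by omega) (by omega) h1 p, by omega⟩
  obtain ⟨S, hS, hp⟩ := key _ hlt
  have := card_le_ncard_cycleLengths (G := G) S
    (h d + (d - (μ d + (G.cycleLengths.ncard + 1) * M)) + 1) ?_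
  · omega
  intro l hl
  obtain ⟨p, hl1⟩ := hp l hl
  have p1 := hE.append_upperRegion (by omega) hlt.le hdR p (hE.seg_upperRegion hlt.le hdR)
  -- The long ear lives in `F (μ d)`, which `upperRegion` omits at its lower end, so it avoids all
  -- the detours.
  have p2 := (hE.ear_path d hd hdR).append p1 (by
    rintro v (rfl | h1) (⟨t, h2, h3, h4⟩ | ⟨t, h2, h3, h4⟩)
    · rfl
    · rfl
    · exact (hE.notMem t (by omega) _ (h4 ▸ h1)).elim
    · have := hE.disj _ _ _ h1 h4
      omega)
  have := p2.mem_cycleLengths (hE.ear_adj d hd hdR) (by omega)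
  convert this using 1
  ring

end IsEarSystem

end SimpleGraph

/-! ### Elimination orders of degree 3-critical graphs -/

namespace SimpleGraph

variable {V : Type*} [Fintype V] {G : SimpleGraph V}

open Classical in
/-- The neighbours of `w` that come after `w` in the order given by `pos`. -/
noncomputable def laterNeighbors (G : SimpleGraph V) (pos : V → ℕ) (w : V) : Finset V :=
  Finset.univ.filter fun x => G.Adj w x ∧ pos w < pos x

theorem mem_laterNeighbors {pos : V → ℕ} {w x : V} :
    x ∈ G.laterNeighbors pos w ↔ G.Adj w x ∧ pos w < pos x := by
  simp [laterNeighbors]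

open Classical in
theorem sum_card_laterNeighbors {pos : V → ℕ} (hpos : Function.Injective pos) :
    ∑ w, (G.laterNeighbors pos w).card = G.edgeFinset.card := by
  have h1 := Finset.sum_card_bipartiteAbove_eq_sum_card_bipartiteBelow
    (s := Finset.univ) (t := Finset.univ) (fun w x => G.Adj w x ∧ pos w < pos x)
  have h2 := G.sum_degrees_eq_twice_card_edges
  have h3 : ∀ w, G.degree w = (G.laterNeighbors pos w).card +
      (Finset.univ.filter fun x => G.Adj x w ∧ pos x < pos w).card := by
    intro w
    rw [← card_neighborFinset_eq_degree, laterNeighbors, ← Finset.card_union_of_disjoint]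
    · congr 1
      ext x
      simp only [mem_neighborFinset, Finset.mem_union, Finset.mem_filter, Finset.mem_univ, true_and]
      constructor
      · intro h
        rcases lt_trichotomy (pos w) (pos x) with h' | h' | h'
        · exact .inl ⟨h, h'⟩
        · exact (h.ne (hpos h')).elim
        · exact .inr ⟨h.symm, h'⟩
      · rintro (h | h)
        · exact h.1
        · exact h.1.symm
    · rw [Finset.disjoint_left]
      intro x hx hx'
      simp only [Finset.mem_filter] at hx hx'
      omega
  simp only [h3, Finset.sum_add_distrib] at h2
  simp only [Finset.bipartiteAbove, Finset.bipartiteBelow] at h1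
  simp only [laterNeighbors] at h2 ⊢
  omega

namespace IsDegreeThreeCritical

theorem exists_few_neighbors (hG : G.IsDegreeThreeCritical) {S : Finset V} (hS : S.Nonempty)
    (hS' : S ≠ Finset.univ) :
    ∃ v ∈ S, ∀ T ⊆ S, (∀ x ∈ T, G.Adj v x) → T.card ≤ 2 := by
  classical
  have h := hG.2 S hS'
  have : Nonempty (S : Set V) := hS.to_subtype
  obtain ⟨v, hv⟩ := (G.induce (S : Set V)).exists_minimal_degree_vertex
  refine ⟨v, v.2, fun T hT hadj => ?_⟩
  have hle : T.card ≤ (G.induce (S : Set V)).degree v := by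
    rw [← card_neighborFinset_eq_degree,
      ← Finset.card_map (Function.Embedding.subtype (· ∈ (S : Set V)))]
    refine Finset.card_le_card fun x hx => ?_
    rw [Finset.mem_map]
    exact ⟨⟨x, hT hx⟩, by simpa using hadj x hx, rfl⟩
  rw [← hv] at hle
  have : (G.induce (S : Set V)).minDegree < 3 := by
    rw [← not_le]
    convert h
  omega

/-- After the removal of any vertex, the graph can be dismantled by removing vertices with at most
two remaining neighbours. -/
theorem exists_elimination (hG : G.IsDegreeThreeCritical) (v : V) :
    ∃ pos : V → ℕ, Function.Injective pos ∧ (∀ w, w ≠ v → pos v < pos w) ∧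
      ∀ w, w ≠ v → (G.laterNeighbors pos w).card ≤ 2 := by
  classical
  have key : ∀ (k : ℕ) (S : Finset V), S.card = k → v ∉ S → ∃ pos : V → ℕ, Set.InjOn pos S ∧
      ∀ w ∈ S, ∀ T ⊆ S, (∀ x ∈ T, G.Adj w x ∧ pos w < pos x) → T.card ≤ 2 := by
    intro k
    induction k with
    | zero =>
      intro S hS _
      rw [Finset.card_eq_zero] at hS
      subst hS
      exact ⟨fun _ => 0, by simp, by simp⟩
    | succ k ih =>
      intro S hS hv
      have hne : S.Nonempty := by
        rw [← Finset.card_pos]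
        omega
      obtain ⟨a, ha, hfew⟩ := hG.exists_few_neighbors hne (by rintro rfl; simp at hv)
      obtain ⟨pos, hinj, hpos⟩ := ih (S.erase a) (by rw [Finset.card_erase_of_mem ha]; omega)
        (fun h => hv (Finset.mem_of_mem_erase h))
      refine ⟨fun w => if w = a then 0 else pos w + 1, ?_, ?_⟩
      · intro x hx y hy hxy
        by_cases h1 : x = a <;> by_cases h2 : y = a <;> simp only [h1, h2, if_true, if_false] at hxy
        · rw [h1, h2]
        · omega
        · omega
        · exact hinj (by simpa [h1] using hx) (by simpa [h2] using hy) (by omega)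
      · intro w hw T hT hadj
        by_cases h1 : w = a
        · subst h1
          exact hfew T hT fun x hx => (hadj x hx).1
        · have h2 : ∀ x ∈ T, x ≠ a ∧ pos w < pos x := by
            intro x hx
            have h3 := (hadj x hx).2
            by_cases h4 : x = a <;> simp only [h1, h4, if_true, if_false] at h3
            · omega
            · exact ⟨h4, by omega⟩
          refine hpos w (by simp [h1, hw]) T (fun x hx => ?_) fun x hx => ⟨(hadj x hx).1, (h2 x hx).2⟩
          exact Finset.mem_erase.2 ⟨(h2 x hx).1, hT hx⟩
  obtain ⟨pos, hinj, hpos⟩ := key _ (Finset.univ.erase v) rfl (by simp)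
  refine ⟨fun w => if w = v then 0 else pos w + 1, ?_, ?_, ?_⟩
  · intro x y hxy
    by_cases h1 : x = v <;> by_cases h2 : y = v <;> simp only [h1, h2, if_true, if_false] at hxy
    · rw [h1, h2]
    · omega
    · omega
    · exact hinj (by simp [h1]) (by simp [h2]) (by omega)
  · intro w hw
    simp [hw]
  · intro w hw
    refine hpos w (by simp [hw]) _ (fun x hx => ?_) fun x hx => ?_
    · rw [mem_laterNeighbors] at hx
      have h3 := hx.2
      by_cases h4 : x = v
      · simp [h4] at h3
      · simp [h4]
    · rw [mem_laterNeighbors] at hx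
      have h3 := hx.2
      by_cases h4 : x = v
      · simp [h4] at h3
      · simp only [hw, h4, if_false] at h3
        exact ⟨hx.1, by omega⟩

/-- In an elimination order every vertex except the last two has at least two later neighbours. -/
theorem elimination_spec (hG : G.IsDegreeThreeCritical) (hn : 3 ≤ Fintype.card V) {v : V}
    {pos : V → ℕ} (hinj : Function.Injective pos) (hv : ∀ w, w ≠ v → pos v < pos w)
    (hpos : ∀ w, w ≠ v → (G.laterNeighbors pos w).card ≤ 2) :
    3 ≤ (G.laterNeighbors pos v).card ∧ ((G.laterNeighbors pos v).card ≤ 3 →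
      ∃ t₁ t₂ : V, G.laterNeighbors pos t₁ = ∅ ∧ G.laterNeighbors pos t₂ = {t₁} ∧
        ∀ w, w ≠ t₁ → w ≠ t₂ → 2 ≤ (G.laterNeighbors pos w).card) := by
  classical
  set f : V → ℕ := fun w => (G.laterNeighbors pos w).card with hf
  obtain ⟨t₁, -, h1⟩ := Finset.exists_max_image Finset.univ pos ⟨v, Finset.mem_univ v⟩
  have hc1 : (Finset.univ.erase t₁).card = Fintype.card V - 1 := by
    rw [Finset.card_erase_of_mem (Finset.mem_univ _), Finset.card_univ]
  obtain ⟨t₂, ht₂, h2⟩ := Finset.exists_max_image (Finset.univ.erase t₁) pos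
    (by rw [← Finset.card_pos]; omega)
  have h21 : t₂ ≠ t₁ := Finset.ne_of_mem_erase ht₂
  have hc2 : ((Finset.univ.erase t₁).erase t₂).card = Fintype.card V - 2 := by
    rw [Finset.card_erase_of_mem ht₂]
    omega
  obtain ⟨x, hx⟩ : ((Finset.univ.erase t₁).erase t₂).Nonempty := by
    rw [← Finset.card_pos]
    omega
  have hvt₁ : v ≠ t₁ := by
    rintro rfl
    have := h1 t₂ (Finset.mem_univ _)
    have := hv _ h21
    omega
  have hvt₂ : v ≠ t₂ := by
    rintro rfl
    simp only [Finset.mem_erase] at hx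
    have := h2 x (by simp [hx])
    have := hv x hx.1
    omega
  have hl1 : G.laterNeighbors pos t₁ = ∅ := by
    rw [Finset.eq_empty_iff_forall_notMem]
    intro x hx
    have := (mem_laterNeighbors.1 hx).2
    have := h1 x (Finset.mem_univ _)
    omega
  have hl2 : G.laterNeighbors pos t₂ ⊆ {t₁} := by
    intro x hx
    by_contra hne
    rw [Finset.mem_singleton] at hne
    have := (mem_laterNeighbors.1 hx).2
    have := h2 x (by simp [hne])
    omega
  have hf1 : f t₁ = 0 := by simp [hf, hl1]
  have hf2 : f t₂ ≤ 1 := by simpa using Finset.card_le_card hl2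
  set Q := ((Finset.univ.erase t₁).erase t₂).erase v with hQ
  have hvQ : v ∈ (Finset.univ.erase t₁).erase t₂ := by simp [hvt₁, hvt₂]
  have hcQ : Q.card = Fintype.card V - 3 := by
    rw [hQ, Finset.card_erase_of_mem hvQ]
    omega
  -- Count edges at their earlier ends: none at `t₁`, at most one at `t₂`, at most two at each
  -- vertex of `Q`. This forces at least three at `v`, and exactly three makes all these bounds
  -- equalities.
  have hsum : f t₁ + (f t₂ + (f v + ∑ w ∈ Q, f w)) + 2 = 2 * Fintype.card V := by
    rw [hQ, Finset.add_sum_erase _ _ hvQ, Finset.add_sum_erase _ _ ht₂,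
      Finset.add_sum_erase _ _ (Finset.mem_univ _), ← hG.1]
    congr 1
    rw [sum_card_laterNeighbors hinj]
  have hQle : ∀ w ∈ Q, f w ≤ 2 := fun w hw => hpos w (Finset.ne_of_mem_erase hw)
  have hsQ : ∑ w ∈ Q, f w ≤ Q.card * 2 := Finset.sum_le_card_nsmul Q f 2 hQle
  refine ⟨by change 3 ≤ f v; omega, fun hv3 => ?_⟩
  change f v ≤ 3 at hv3
  refine ⟨t₁, t₂, hl1, ?_, fun w hw1 hw2 => ?_⟩
  · refine Finset.eq_of_subset_of_card_le hl2 ?_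
    rw [Finset.card_singleton]
    change 1 ≤ f t₂
    omega
  · change 2 ≤ f w
    by_cases hwv : w = v
    · subst hwv
      omega
    have hwQ : w ∈ Q := by simp [hQ, hwv, hw1, hw2]
    have h3 := Finset.add_sum_erase Q f hwQ
    have h4 : ∑ x ∈ Q.erase w, f x ≤ (Q.erase w).card * 2 := Finset.sum_le_card_nsmul _ f 2
      fun x hx => hQle x (Finset.mem_of_mem_erase hx)
    rw [Finset.card_erase_of_mem hwQ] at h4
    have : 0 < Q.card := Finset.card_pos.2 ⟨w, hwQ⟩
    omega

/-- Average degree below 4 supplies `u` of degree at most 3, so the edge count is tight. A vertex `w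
≠ u` without earlier neighbours would have at most two neighbours, while an elimination starting at
`w` requires three. -/
theorem exists_order (hG : G.IsDegreeThreeCritical) (hn : 3 ≤ Fintype.card V) :
    ∃ (pos : V → ℕ) (u t₁ t₂ : V), (G.laterNeighbors pos u).card ≤ 3 ∧
      (∀ w, w ≠ u → (G.laterNeighbors pos w).card ≤ 2) ∧
      (∀ w, w ≠ u → ∃ x, w ∈ G.laterNeighbors pos x) ∧
      G.laterNeighbors pos t₁ = ∅ ∧ G.laterNeighbors pos t₂ = {t₁} ∧
      ∀ w, w ≠ t₁ → w ≠ t₂ → 2 ≤ (G.laterNeighbors pos w).card := by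
  classical
  obtain ⟨u, hu⟩ : ∃ u, G.degree u ≤ 3 := by
    by_contra! hcon
    have h1 := Finset.card_nsmul_le_sum Finset.univ (fun w => G.degree w) 4 fun w _ => hcon w
    have h2 := G.sum_degrees_eq_twice_card_edges
    have h3 := hG.1
    rw [smul_eq_mul, Finset.card_univ] at h1
    have h4 : G.edgeFinset.card + 2 = 2 * Fintype.card V := by convert h3
    omega
  have hsub : ∀ (pos : V → ℕ) w, G.laterNeighbors pos w ⊆ G.neighborFinset w := by
    intro pos w x hx
    simpa using (mem_laterNeighbors.1 hx).1
  obtain ⟨pos, hinj, hfirst, hpos⟩ := hG.exists_elimination u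
  have h3 : (G.laterNeighbors pos u).card ≤ 3 :=
    (Finset.card_le_card (hsub pos u)).trans (by simpa using hu)
  obtain ⟨t₁, t₂, ht⟩ := (hG.elimination_spec hn hinj hfirst hpos).2 h3
  refine ⟨pos, u, t₁, t₂, h3, hpos, fun w hw => ?_, ht⟩
  by_contra! hcon
  obtain ⟨pos', hinj', hfirst', hpos'⟩ := hG.exists_elimination w
  have h4 := (hG.elimination_spec hn hinj' hfirst' hpos').1
  have h5 : G.laterNeighbors pos' w ⊆ G.laterNeighbors pos w := by
    intro x hx
    have hwx := (mem_laterNeighbors.1 hx).1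
    rw [mem_laterNeighbors]
    refine ⟨hwx, ?_⟩
    have := hcon x
    rw [mem_laterNeighbors] at this
    rcases lt_trichotomy (pos w) (pos x) with h' | h' | h'
    · exact h'
    · exact (hwx.ne (hinj h')).elim
    · exact (this ⟨hwx.symm, h'⟩).elim
  have := Finset.card_le_card h5
  have := hpos w hw
  omega

end IsDegreeThreeCritical

/-- Taking the longest increasing path makes rank drop along every later neighbour, and by exactly
one along some of them. -/
theorem exists_rank (G : SimpleGraph V) (pos : V → ℕ) :
    ∃ rank : V → ℕ, ∀ w, rank w = (G.laterNeighbors pos w).sup fun x => rank x + 1 := by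
  have wf : WellFounded fun x w : V => pos w < pos x := by
    have : IsTrans V fun x w => pos w < pos x := ⟨fun _ _ _ h h' => h'.trans h⟩
    have : Std.Irrefl fun x w : V => pos w < pos x := ⟨fun _ => lt_irrefl _⟩
    exact Finite.wellFounded_of_trans_of_irrefl _
  refine ⟨wf.fix fun w ih => (G.laterNeighbors pos w).attach.sup
    fun x => ih x.1 (mem_laterNeighbors.1 x.2).2 + 1, fun w => ?_⟩
  rw [wf.fix_eq]
  exact Finset.sup_attach (G.laterNeighbors pos w) (fun x => wf.fix _ x + 1)

theorem exists_depth {W : Type*} (pos : W → ℕ) (u : W) (p : W → W)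
    (hp : ∀ w, w ≠ u → pos (p w) < pos w) :
    ∃ dep : W → ℕ, dep u = 0 ∧ ∀ w, w ≠ u → dep w = dep (p w) + 1 := by
  classical
  have wf : WellFounded fun x w : W => pos x < pos w := (measure pos).wf
  set dep : W → ℕ := wf.fix fun w ih => if h : w = u then 0 else ih (p w) (hp w h) + 1 with hdep
  have h : ∀ w, dep w = if w = u then 0 else dep (p w) + 1 := by
    intro w
    rw [hdep, wf.fix_eq]
    by_cases hw : w = u <;> simp [hw]
  exact ⟨dep, by simp [h u], fun w hw => by rw [h w, if_neg hw]⟩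

end SimpleGraph

/-! ### Few ranks and small rank classes -/

namespace SimpleGraph

theorem IsRootedTree.mono {V : Type*} {G : SimpleGraph V} {S S' : Set V} {par : V → V}
    {dep : V → ℕ} (h : G.IsRootedTree S par dep) (hS : S' ⊆ S)
    (hpar : ∀ x ∈ S', dep x ≠ 0 → par x ∈ S') : G.IsRootedTree S' par dep where
  adj x hx := h.adj x (hS hx)
  par_mem := hpar
  dep_par x hx := h.dep_par x (hS hx)
  root_unique x hx y hy := h.root_unique x (hS hx) y (hS hy)

section EarSystem

variable {V : Type*} {G : SimpleGraph V} {par b : V → V} {dep : V → ℕ}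

/-- In a tree where every vertex `x` of depth at least two has a neighbour `b x`, other than its
parent, of smaller depth, each path to the root carries an ear system. -/
theorem IsRootedTree.isEarSystem (h : G.IsRootedTree Set.univ par dep)
    (hb : ∀ x, 2 ≤ dep x → G.Adj x (b x) ∧ dep (b x) < dep x ∧ b x ≠ par x) (w : V) :
    G.IsEarSystem (dep w) (ancestor par dep w)
      (fun j => {v | meetDepth par dep v w = j ∧ j < dep v})
      (fun d => meetDepth par dep (b (ancestor par dep w d)) w)
      (fun d => b (ancestor par dep w d))
      (fun d => dep (b (ancestor par dep w d)) -
        meetDepth par dep (b (ancestor par dep w d)) w) where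
  inj i hi j hj hij := by
    rw [← h.dep_ancestor trivial hi, hij, h.dep_ancestor trivial hj]
  adj i hi := h.adj_ancestor trivial hi
  notMem i hi j hj := by
    obtain ⟨h1, h2⟩ := hj
    have hd := h.dep_ancestor (x := w) trivial hi
    rw [hd] at h2
    have := (h.le_meetDepth_iff (x := ancestor par dep w i) (y := w) (t := i) trivial trivial).2
      ⟨hd.ge, hi, h.ancestor_ancestor trivial le_rfl hi⟩
    omega
  disj i j v hi hj := hi.1.symm.trans hj.1
  ear_lt d hd hdR := by
    have hdep := h.dep_ancestor (x := w) trivial hdR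
    obtain ⟨-, h2, h3⟩ := hb (ancestor par dep w d) (by omega)
    have h4 := h.meetDepth_le_left (x := b (ancestor par dep w d)) (y := w) trivial trivial
    -- Otherwise the second neighbour is the ancestor of `w` at depth `d - 1`, which is the excluded
    -- parent.
    by_contra hlt
    have h5 : meetDepth par dep (b (ancestor par dep w d)) w = dep (b (ancestor par dep w d)) := by
      omega
    have h6 := h.ancestor_meetDepth (x := b (ancestor par dep w d)) (y := w) trivial trivial
    rw [h5, ancestor_self] at h6
    obtain ⟨k, rfl⟩ : ∃ k, d = k + 1 := ⟨d - 1, by omega⟩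
    rw [IsRootedTree.par_ancestor (par := par) hdR] at h3
    refine h3 (h6.trans ?_)
    congr 1
    omega
  ear_adj d hd hdR := (hb _ (by rwa [h.dep_ancestor trivial hdR])).1
  ear_path d hd hdR := by
    set x := b (ancestor par dep w d)
    have h1 := h.meetDepth_le_left (x := x) (y := w) trivial trivial
    have h3 := h.ancestor_meetDepth (x := x) (y := w) trivial trivial
    rw [← h3]
    refine (h.hasPathIn_ancestor trivial h1).mono ?_
    rintro v ⟨j, hj1, hj2, rfl⟩
    rcases hj1.eq_or_lt with rfl | hj
    · exact Set.mem_insert _ _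
    · refine Set.mem_insert_of_mem _ ?_
      have hdj := h.dep_ancestor (x := x) trivial hj2
      refine ⟨eq_of_forall_le_iff fun t => ?_, by rwa [hdj]⟩
      rw [h.le_meetDepth_iff trivial trivial, h.le_meetDepth_iff trivial trivial, hdj]
      constructor
      · rintro ⟨e1, e2, e3⟩
        rw [h.ancestor_ancestor trivial e1 hj2] at e3
        exact ⟨by omega, e2, e3⟩
      · rintro ⟨e1, e2, e3⟩
        have : t ≤ meetDepth par dep x w := (h.le_meetDepth_iff trivial trivial).2 ⟨e1, e2, e3⟩
        rw [h.ancestor_ancestor trivial (by omega) hj2]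
        exact ⟨by omega, e2, e3⟩

/-- An ear passing over `r` starts with an edge from the part of the root path deeper than `r` to a
vertex whose meet with `w` has depth at most `r`. Both sides are trees, and the first is a path,
whence the 2. -/
theorem IsRootedTree.congestion_le [Finite V] (h : G.IsRootedTree Set.univ par dep)
    (hb : ∀ x, 2 ≤ dep x → G.Adj x (b x) ∧ dep (b x) < dep x ∧ b x ≠ par x) (w : V) (r : ℕ) :
    ((Finset.Icc 2 (dep w)).filter fun d =>
      r < d ∧ meetDepth par dep (b (ancestor par dep w d)) w ≤ r).card ≤
      crossingBound 2 G.cycleLengths.ncard := by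
  classical
  set C := (Finset.Icc 2 (dep w)).filter fun d =>
      r < d ∧ meetDepth par dep (b (ancestor par dep w d)) w ≤ r
  have hsys := h.isEarSystem hb w
  rw [← Finset.card_image_of_injOn (f := ancestor par dep w) (s := C) fun i hi j hj hij =>
    hsys.inj i (by simp_all [C]) j (by simp_all [C]) hij]
  set A : Set V := {v | ∃ t, r < t ∧ t ≤ dep w ∧ v = ancestor par dep w t}
  set B : Set V := {v | meetDepth par dep v w ≤ r}
  -- Depths are shifted so that the truncated path has its root at depth `r + 1` of the original
  -- tree.
  have hA : G.IsRootedTree A par (fun v => dep v - (r + 1)) := by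
    have hdep : ∀ v ∈ A, dep v ≠ 0 := by
      rintro _ ⟨t, h1, h2, rfl⟩
      rw [h.dep_ancestor trivial h2]
      omega
    refine ⟨fun x hx _ => h.adj x trivial (hdep x hx), ?_, fun x hx h0 => ?_, ?_⟩
    · rintro _ ⟨t, h1, h2, rfl⟩ h0
      change dep _ - _ ≠ 0 at h0
      rw [h.dep_ancestor trivial h2] at h0
      obtain ⟨k, rfl⟩ : ∃ k, t = k + 1 := ⟨t - 1, by omega⟩
      rw [IsRootedTree.par_ancestor (par := par) h2]
      exact ⟨k, by omega, by omega, rfl⟩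
    · have := h.dep_par x trivial (hdep x hx)
      omega
    · rintro _ ⟨t, h1, h2, rfl⟩ _ ⟨t', h3, h4, rfl⟩ h5 h6
      change dep _ - _ = 0 at h5 h6
      rw [h.dep_ancestor trivial h2] at h5
      rw [h.dep_ancestor trivial h4] at h6
      rw [show t = t' by omega]
  have hB : G.IsRootedTree B par dep := by
    refine h.mono (Set.subset_univ _) fun x hx h0 => ?_
    change meetDepth par dep _ w ≤ r at hx ⊢
    refine le_trans ?_ hx
    obtain ⟨e1, e2, e3⟩ := (h.le_meetDepth_iff (x := par x) (y := w)
      (t := meetDepth par dep (par x) w) trivial trivial).1 le_rfl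
    have hdp := h.dep_par x trivial h0
    have hpx : par x = ancestor par dep x (dep x - 1) := by
      rw [← IsRootedTree.par_ancestor (by omega), Nat.sub_add_cancel (by omega), ancestor_self]
    have hanc : ∀ t ≤ dep (par x), ancestor par dep (par x) t = ancestor par dep x t := by
      intro t ht
      conv_lhs => rw [hpx]
      exact h.ancestor_ancestor trivial (by omega) (by omega)
    exact (h.le_meetDepth_iff trivial trivial).2 ⟨by omega, e2, (hanc _ e1).symm.trans e3⟩
  refine hA.card_le_crossingBound hB (β := b) ?_ ?_ _ ?_
  · rw [Set.disjoint_left]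
    rintro _ ⟨t, h1, h2, rfl⟩ (h3 : meetDepth par dep _ w ≤ r)
    have := (h.le_meetDepth_iff (x := ancestor par dep w t) (y := w) (t := t) trivial trivial).2
      ⟨(h.dep_ancestor trivial h2).ge, h2, h.ancestor_ancestor trivial le_rfl h2⟩
    omega
  · intro c _ Y hY
    have : Y.card ≤ 1 := by
      rw [Finset.card_le_one]
      have key : ∀ x ∈ Y, x = ancestor par dep w (dep c + 1) := by
        intro x hx
        obtain ⟨⟨t, h1, h2, rfl⟩, h0, h3⟩ := hY x hx
        have hd := h.dep_ancestor (x := w) trivial h2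
        have := h.dep_par (ancestor par dep w t) trivial (by omega)
        rw [h3, hd] at this
        rw [this]
      exact fun x hx x' hx' => (key x hx).trans (key x' hx').symm
    split_ifs <;> omega
  · intro x hx
    obtain ⟨d, hd, rfl⟩ := Finset.mem_image.1 hx
    simp only [C, Finset.mem_filter, Finset.mem_Icc] at hd
    exact ⟨⟨d, hd.2.1, hd.1.2, rfl⟩, hd.2.2, hsys.ear_adj d hd.1.1 hd.1.2⟩

theorem IsRootedTree.dep_le [Finite V] (h : G.IsRootedTree Set.univ par dep)
    (hb : ∀ x, 2 ≤ dep x → G.Adj x (b x) ∧ dep (b x) < dep x ∧ b x ≠ par x) (w : V) {H : ℕ}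
    (hH : crossingBound 2 G.cycleLengths.ncard = H) :
    dep w ≤ (G.cycleLengths.ncard + 1) * ((G.cycleLengths.ncard + 1) * (H + H * H + 2)) := by
  rcases Nat.lt_or_ge (dep w) 2 with h1 | h1
  · exact (Nat.le_of_lt_succ h1).trans (Nat.mul_pos (by omega) (Nat.mul_pos (by omega) (by omega)))
  · subst hH
    have hsys := h.isEarSystem hb w
    exact hsys.le_mul_of_ear_le h1 fun d h2 hd =>
      hsys.ear_le_of_congestion_le (h.congestion_le hb w) h2 hd

end EarSystem

variable {V : Type*} [Fintype V] {G : SimpleGraph V}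

/-- The first factor bounds the number of ranks, the second the number of vertices of each rank. -/
theorem IsDegreeThreeCritical.card_le_mul (hG : G.IsDegreeThreeCritical)
    (hn : 3 ≤ Fintype.card V) {H : ℕ} (hH : crossingBound 2 G.cycleLengths.ncard = H) :
    Fintype.card V ≤ ((G.cycleLengths.ncard + 1) *
      ((G.cycleLengths.ncard + 1) * (H + H * H + 2)) + 1) *
        crossingBound 3 G.cycleLengths.ncard := by
  classical
  obtain ⟨pos, u, t₁, t₂, hu, hle, hearlier, ht₁, ht₂, hlater⟩ := hG.exists_order hn
  obtain ⟨rank, hrank⟩ := G.exists_rank pos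
  have hlt : ∀ w x, x ∈ G.laterNeighbors pos w → rank x < rank w := fun w x hx => by
    rw [hrank w]
    exact Finset.le_sup (f := fun x => rank x + 1) hx
  have hr1 : rank t₁ = 0 := by rw [hrank, ht₁, Finset.sup_empty]; rfl
  have hr2 : rank t₂ = 1 := by rw [hrank, ht₂, Finset.sup_singleton, hr1]
  have hnext : ∀ w, ∃ x, w ≠ t₁ → x ∈ G.laterNeighbors pos w ∧ rank x + 1 = rank w := by
    intro w
    by_cases hw : w = t₁
    · exact ⟨w, fun h => (h hw).elim⟩
    have hne : (G.laterNeighbors pos w).Nonempty := by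
      by_cases hw2 : w = t₂
      · rw [hw2, ht₂]
        exact Finset.singleton_nonempty _
      · rw [← Finset.card_pos]
        have := hlater w hw hw2
        omega
    obtain ⟨x, hx, h⟩ := Finset.exists_mem_eq_sup _ hne fun x => rank x + 1
    exact ⟨x, fun _ => ⟨hx, by rw [hrank w, h]⟩⟩
  choose next hnext using hnext
  have hne₁ : ∀ {w}, rank w ≠ 0 → w ≠ t₁ := by
    rintro w h rfl
    exact h hr1
  -- The two vertices that may lack a second later neighbour have ranks 0 and 1.
  have hother : ∀ w, ∃ x, 2 ≤ rank w → x ∈ G.laterNeighbors pos w ∧ x ≠ next w := by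
    intro w
    by_cases hw : 2 ≤ rank w
    · have hw1 : w ≠ t₁ := hne₁ (by omega)
      have := hlater w hw1 (by rintro rfl; omega)
      obtain ⟨x, hx, h⟩ := Finset.exists_mem_ne (s := G.laterNeighbors pos w) (by omega) (next w)
      exact ⟨x, fun _ => ⟨hx, h⟩⟩
    · exact ⟨w, fun h => (hw h).elim⟩
  choose other hother using hother
  have htree : G.IsRootedTree Set.univ next rank := by
    refine ⟨fun x _ h => (mem_laterNeighbors.1 (hnext x (hne₁ h)).1).1, fun _ _ _ => trivial,
      fun x _ h => (hnext x (hne₁ h)).2, ?_⟩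
    have : ∀ x, rank x = 0 → x = t₁ := fun x hx => by
      by_contra h
      have := (hnext x h).2
      omega
    exact fun x _ y _ hx hy => (this x hx).trans (this y hy).symm
  have hdep := fun w => htree.dep_le (b := other) (fun x hx =>
    ⟨(mem_laterNeighbors.1 (hother x hx).1).1, hlt _ _ (hother x hx).1, (hother x hx).2⟩) w hH
  have hprev : ∀ w, ∃ x, w ≠ u → w ∈ G.laterNeighbors pos x := by
    intro w
    by_cases hw : w = u
    · exact ⟨w, fun h => (h hw).elim⟩
    · obtain ⟨x, hx⟩ := hearlier w hw
      exact ⟨x, fun _ => hx⟩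
  choose prev hprev using hprev
  obtain ⟨dep, hdu, hdw⟩ := exists_depth pos u prev
    fun w hw => (mem_laterNeighbors.1 (hprev w hw)).2
  have hdu' : ∀ {w}, dep w ≠ 0 → w ≠ u := by
    rintro w h rfl
    exact h hdu
  have hdu'' : ∀ {w}, dep w = 0 → w = u := fun {w} h => by
    by_contra hw
    have := hdw w hw
    omega
  have hclass : ∀ r, (Finset.univ.filter fun w => rank w = r).card ≤
      crossingBound 3 G.cycleLengths.ncard := by
    intro r
    -- Earlier neighbours have larger rank, so this set is closed under `prev`.
    have hA : G.IsRootedTree {w | r ≤ rank w} prev dep := by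
      refine ⟨fun x _ h => (mem_laterNeighbors.1 (hprev x (hdu' h))).1.symm, fun x hx h => ?_,
        fun x _ h => (hdw x (hdu' h)).symm, fun x _ y _ hx hy => (hdu'' hx).trans (hdu'' hy).symm⟩
      exact le_trans hx (hlt _ _ (hprev x (hdu' h))).le
    have hB : G.IsRootedTree {w | rank w < r} next rank := by
      refine htree.mono (Set.subset_univ _) fun x hx h => ?_
      have := (hnext x (hne₁ h)).2
      simp only [Set.mem_ofPred_eq] at hx ⊢
      omega
    rcases Nat.eq_zero_or_pos r with rfl | hr
    · have h1 : (Finset.univ.filter fun w => rank w = 0).card ≤ 1 := by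
        rw [Finset.card_le_one]
        intro x hx y hy
        exact htree.root_unique x trivial y trivial (by simpa using hx) (by simpa using hy)
      refine h1.trans ?_
      cases G.cycleLengths.ncard <;> simp [crossingBound]
    refine hA.card_le_crossingBound hB (β := next) ?_ ?_ _ ?_
    · rw [Set.disjoint_left]
      intro x hx hx'
      simp only [Set.mem_ofPred_eq] at hx hx'
      omega
    · intro c _ Y hY
      have hsub : Y ⊆ G.laterNeighbors pos c := fun x hx => by
        obtain ⟨-, h0, rfl⟩ := hY x hx
        exact hprev x (hdu' h0)
      have h1 := Finset.card_le_card hsub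
      split_ifs with h0
      · rw [hdu'' h0] at h1
        omega
      · have := hle c (hdu' h0)
        omega
    · intro x hx
      have hx : rank x = r := by simpa using hx
      obtain ⟨h1, h2⟩ := hnext x (hne₁ (by omega))
      refine ⟨hx.ge, ?_, (mem_laterNeighbors.1 h1).1⟩
      simp only [Set.mem_ofPred_eq]
      omega
  have hmaps : ∀ w ∈ (Finset.univ : Finset V), rank w ∈ Finset.range ((G.cycleLengths.ncard + 1) *
      ((G.cycleLengths.ncard + 1) * (H + H * H + 2)) + 1) := fun w _ => by
    rw [Finset.mem_range]
    exact Nat.lt_succ_of_le (hdep w)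
  have := Finset.card_le_mul_card_image_of_maps_to hmaps _ fun r _ => hclass r
  rw [Finset.card_range, Finset.card_univ] at this
  rwa [mul_comm]

/-! ### Numerical estimates and conclusion -/

theorem crossingBound_two_add_one (s : ℕ) : crossingBound 2 s + 1 = 2 ^ (s + 1) := by
  induction s with
  | zero => rfl
  | succ s ih =>
    rw [pow_succ, ← ih, crossingBound]
    ring

theorem crossingBound_three_le (s : ℕ) : 2 * crossingBound 3 s + 1 = 3 ^ (s + 1) := by
  induction s with
  | zero => rfl
  | succ s ih =>
    rw [pow_succ, ← ih, crossingBound]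
    ring

theorem sq_le_four_mul_two_pow (s : ℕ) : (s + 1) * (s + 1) ≤ 4 * 2 ^ s := by
  induction s with
  | zero => norm_num
  | succ s ih =>
    rcases Nat.lt_or_ge s 2 with h | h
    · interval_cases s <;> norm_num
    · rw [pow_succ]
      nlinarith

/-- The base is 24 = 2 · 4 · 3: the 2 pays for `(s + 1) ^ 2`, the 4 for the square of the
congestion, the 3 for the rank classes. -/
theorem IsDegreeThreeCritical.card_le_pow (hG : G.IsDegreeThreeCritical) :
    Fintype.card V ≤ 24 ^ (G.cycleLengths.ncard + 2) := by
  set s := G.cycleLengths.ncard with hs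
  rcases Nat.lt_or_ge (Fintype.card V) 3 with hn | hn
  · have : 1 ≤ 24 ^ s := Nat.one_le_pow _ _ (by norm_num)
    rw [pow_add]
    omega
  have h1 := hG.card_le_mul hn (H := 2 ^ (s + 1) - 1) (by
    have := crossingBound_two_add_one s
    rw [← hs]
    omega)
  rw [← hs] at h1
  obtain ⟨H, hH⟩ : ∃ H, 2 ^ (s + 1) = H + 1 := ⟨2 ^ (s + 1) - 1, by
    have : 1 ≤ 2 ^ (s + 1) := Nat.one_le_pow _ _ (by norm_num)
    omega⟩
  rw [hH, Nat.add_sub_cancel] at h1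
  have hH1 : 1 ≤ H := by
    have : 1 ≤ 2 ^ s := Nat.one_le_pow _ _ (by norm_num)
    rw [pow_succ] at hH
    omega
  have h2 : H + H * H + 2 ≤ 4 ^ (s + 1) := by
    rw [show 4 = 2 * 2 by norm_num, mul_pow, hH]
    nlinarith
  have h3 : crossingBound 3 s ≤ 3 ^ (s + 1) := by
    have := crossingBound_three_le s
    omega
  have h4 : (s + 1) * ((s + 1) * (H + H * H + 2)) ≤ 4 * 2 ^ s * 4 ^ (s + 1) := by
    rw [← mul_assoc]
    exact Nat.mul_le_mul (sq_le_four_mul_two_pow s) h2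
  have h5 : 1 ≤ 2 ^ s * 4 ^ (s + 1) := Nat.mul_pos (by positivity) (by positivity)
  calc Fintype.card V ≤ _ := h1
    _ ≤ (5 * (2 ^ s * 4 ^ (s + 1))) * 3 ^ (s + 1) := Nat.mul_le_mul (by linarith) h3
    _ = 60 * 24 ^ s := by
      rw [show 24 = 2 * 4 * 3 by norm_num, mul_pow, mul_pow]
      ring
    _ ≤ 24 ^ (s + 2) := by
      rw [pow_add, mul_comm]
      exact Nat.mul_le_mul_left _ (by norm_num)

end SimpleGraph

theorem mainTheorem1 :
    ∃ C : ℝ, ∀ (V : Type*) [Fintype V] (G : SimpleGraph V), G.IsDegreeThreeCritical →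
      Real.logb 2 (Fintype.card V : ℝ) / (3 + Real.logb 2 3) - C ≤ (G.cycleLengths.ncard : ℝ) := by
  refine ⟨2, fun V _ G hG => ?_⟩
  have h24 : (3 : ℝ) + Real.logb 2 3 = Real.logb 2 24 := by
    rw [show (24 : ℝ) = 2 ^ (3 : ℕ) * 3 by norm_num,
      Real.logb_mul (by norm_num) (by norm_num), Real.logb_pow]
    norm_num
  have hpos : 0 < Real.logb 2 24 := Real.logb_pos (by norm_num) (by norm_num)
  rw [h24, sub_le_iff_le_add, div_le_iff₀ hpos]
  -- For empty `V` the convention `Real.logb 2 0 = 0` makes the bound trivial.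
  rcases Nat.eq_zero_or_pos (Fintype.card V) with h0 | h0
  · rw [h0, Nat.cast_zero, Real.logb_zero]
    positivity
  have h1 : (Fintype.card V : ℝ) ≤ 24 ^ (G.cycleLengths.ncard + 2) := by
    exact_mod_cast hG.card_le_pow
  calc Real.logb 2 (Fintype.card V) ≤ Real.logb 2 (24 ^ (G.cycleLengths.ncard + 2)) :=
        Real.logb_le_logb_of_le (by norm_num) (by exact_mod_cast h0) h1
    _ = _ := by
      rw [Real.logb_pow]
      push_cast
      ring
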